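/- Let $k$ be a commutative artinian ring, let $E$ be the minimal injective cogenerator of $k$ (an injective hull of $\bigoplus_{\mathfrak m} k/\mathfrak m$, $\mathfrak m$ running over the maximal ideals) and put $D=\mathrm{Hom}_k(-,E)$. Let $\mathcal A$ be a $k$-linear abelian category which is Hom-finite, that is, all $k$-modules $\mathrm{Hom}_{\mathcal A}(X,Y)$ are finitely generated. A morphism $f$ is *projectively trivial* if $\mathrm{Ext}^1_{\mathcal A}(f,-)=0$ and *injectively trivial* if $\mathrm{Ext}^1_{\mathcal A}(-,f)=0$; let $\underline{\mathcal A}$ and $\overline{\mathcal A}$ be the factor categories of $\mathcal A$ modulo projectively, respectively injectively, trivial morphisms. Assume that $\mathcal A$ has Auslander–Reiten duality: there is a $k$-linear equivalence $\tau\colon\underline{\mathcal A}\to\overline{\mathcal A}$ together with $k$-linear isomorphisms $D\,\mathrm{Ext}^1_{\mathcal A}(X,Y)\cong\overline{\mathrm{Hom}}_{\mathcal A}(Y,\tau X)$, natural in $X$ and $Y$. For an object $K$ put $\Gamma(K)=\mathrm{End}_{\mathcal A}(K)$, let $K^n$ be the direct sum of $n$ copies of $K$, and let $\mathrm{add}\,K$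 be the class of direct summands of the objects $K^n$, $n\ge 0$. A morphism $c\colon X\to Y$ (in $\mathcal A$, or in a module category) is *right minimal* if every endomorphism $e$ of $X$ with $c\circ e=c$ is an automorphism. A morphism $\alpha\colon X\to Y$ in $\mathcal A$ is *right $C$-determined* if every $t\colon T\to Y$ such that $t\circ\phi$ factors through $\alpha$ for all $\phi\colon C\to T$ itself factors through $\alpha$. An object $X$ is *present in ${}^C[\to Y\rangle_{\mathrm{epi}}$* if there is a right minimal epimorphism $X\to Y$ that is right $C$-determined. A *universal extension* of $Y$ by $K$, where the left $\Gamma(K)$-module $\mathrm{Ext}^1_{\mathcal A}(Y,K)$ is finitely generated, is a short exact sequence $\xi\colon 0\to\bar K\to\bar X\to Y\to 0$ with $\bar K\in\mathrm{add}\,K$ such that the map of $\Gamma(K)$-modules $\mathrm{Hom}_{\mathcal A}(\bar K,K)\to\mathrm{Ext}^1_{\mathcal A}(Y,K)$, sending $u$ to the class of the pushout of $\xi$ along $u$, is surjective and right minimal. **Proposition.** Let $K,Y$ be objects of $\mathcal A$. There is a natural number $n=n(K,Y)$ with the following property. Let $C$ be an object with $C\cong\tau^{-1}K$ in $\underline{\mathcal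 A}$, let $0\to\bar K\to\bar X\to Y\to 0$ be a universal extension of $Y$ by $K$, and let $X$ be an object present in ${}^C[\to Y\rangle_{\mathrm{epi}}$. Then there are a direct summand $K'$ of $K^n$ and an exact sequence $$0\longrightarrow\bar K\longrightarrow\bar X\oplus K'\longrightarrow X\longrightarrow 0 .$$ In particular, $X$ is a quotient object of $\bar X\oplus K^n$. -/

import Mathlib

open CategoryTheory CategoryTheory.Limits

universe w v u t

namespace ARUniv

noncomputable section

/-! ### Right minimal and right determined morphisms, additive closure -/

section Basic

variable {A : Type u} [Category.{v} A]

/-- `α : X ⟶ Y` is right minimal: every endomorphism `e` of `X` with `α ∘ e = α` is an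
automorphism. -/
def IsRightMinimal {X Y : A} (α : X ⟶ Y) : Prop :=
  ∀ e : X ⟶ X, e ≫ α = α → IsIso e

/-- `α : X ⟶ Y` is right `C`-determined: a morphism `t : T ⟶ Y` factors through `α` as soon as
`t ∘ φ` factors through `α` for each `φ : C ⟶ T`. -/
def IsRightDetermined (C : A) {X Y : A} (α : X ⟶ Y) : Prop :=
  ∀ ⦃T : A⦄ (t : T ⟶ Y),
    (∀ φ : C ⟶ T, ∃ s : C ⟶ X, s ≫ α = φ ≫ t) → ∃ s : T ⟶ X, s ≫ α = t

/-- `X` is present in `^C[→ Y⟩_epi`: there is a right minimal epimorphism `X ⟶ Y` that is right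
`C`-determined. -/
def IsPresent (C Y X : A) : Prop :=
  ∃ α : X ⟶ Y, Epi α ∧ IsRightMinimal α ∧ IsRightDetermined C α

variable [Abelian A]

instance abelian_hasFiniteBiproducts : HasFiniteBiproducts A := Abelian.hasFiniteBiproducts

/-- The direct sum `K ^ n` of `n` copies of `K`. -/
abbrev power (K : A) (n : ℕ) : A := ⨁ (fun _ : Fin n => K)

/-- `X` is a direct summand of `Z`. -/
def IsDirectSummand (X Z : A) : Prop :=
  ∃ X' : A, Nonempty (X ⊞ X' ≅ Z)

/-- `X` lies in `add K`: it is a direct summand of a finite direct sum of copies of `K`. -/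
def InAdd (K X : A) : Prop :=
  ∃ n : ℕ, IsDirectSummand X (power K n)

end Basic

/-! ### Ext groups as modules over endomorphism rings, connecting maps, universal extensions -/

section Extensions

variable {A : Type u} [Category.{v} A] [Abelian A] [HasExt.{w} A]

/-- The natural left module structure of `Ext^n(Y, K)` over `Γ(K) = End K`
(multiplication in `End K` is composition `f * g = f ∘ g`). -/
instance extModuleEnd (Y K : A) (n : ℕ) : Module (End K) (Abelian.Ext.{w} Y K n) where
  smul f e := e.comp (Abelian.Ext.mk₀ (End.asHom f)) (add_zero n)
  one_smul e := Abelian.Ext.comp_mk₀_id e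
  mul_smul f g e := by
    change e.comp (Abelian.Ext.mk₀ (End.asHom g ≫ End.asHom f)) (add_zero n) =
      (e.comp (Abelian.Ext.mk₀ (End.asHom g)) (add_zero n)).comp
        (Abelian.Ext.mk₀ (End.asHom f)) (add_zero n)
    rw [← Abelian.Ext.mk₀_comp_mk₀, Abelian.Ext.comp_assoc_of_third_deg_zero]
  smul_zero f := Abelian.Ext.zero_comp _ _ _ _ _
  smul_add f e e' := Abelian.Ext.add_comp _ _ _ _
  add_smul f g e := by
    change e.comp (Abelian.Ext.mk₀ (End.asHom f + End.asHom g)) (add_zero n) =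
      e.comp (Abelian.Ext.mk₀ (End.asHom f)) (add_zero n) +
        e.comp (Abelian.Ext.mk₀ (End.asHom g)) (add_zero n)
    rw [Abelian.Ext.mk₀_add, Abelian.Ext.comp_add]
  zero_smul e := by
    change e.comp (Abelian.Ext.mk₀ (0 : K ⟶ K)) (add_zero n) = 0
    rw [Abelian.Ext.mk₀_zero, Abelian.Ext.comp_zero]

/-- The connecting map `c(ξ, Z) : Hom(K, Z) → Ext¹(Y, Z)`, `u ↦ [u.ξ]`, of a short exact sequence
`ξ : 0 ⟶ K ⟶ X ⟶ Y ⟶ 0`, as a morphism of `Γ(Z)`-modules. -/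
def connectingMap {ξ : ShortComplex A} (hξ : ξ.ShortExact) (Z : A) :
    (ξ.X₁ ⟶ Z) →ₗ[End Z] Abelian.Ext.{w} ξ.X₃ Z 1 where
  toFun f := hξ.extClass.comp (Abelian.Ext.mk₀ f) (add_zero 1)
  map_add' f g := by rw [Abelian.Ext.mk₀_add, Abelian.Ext.comp_add]
  map_smul' r f := by
    change hξ.extClass.comp (Abelian.Ext.mk₀ (f ≫ End.asHom r)) (add_zero 1) =
      (hξ.extClass.comp (Abelian.Ext.mk₀ f) (add_zero 1)).comp
        (Abelian.Ext.mk₀ (End.asHom r)) (add_zero 1)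
    rw [← Abelian.Ext.mk₀_comp_mk₀, Abelian.Ext.comp_assoc_of_third_deg_zero]

/-- A morphism `c : M → N` of modules is right minimal: every endomorphism `e` of `M` with
`c ∘ e = c` is an automorphism. -/
def IsRightMinimalLinear {R M N : Type*} [Ring R] [AddCommGroup M] [Module R M]
    [AddCommGroup N] [Module R N] (c : M →ₗ[R] N) : Prop :=
  ∀ e : M →ₗ[R] M, c ∘ₗ e = c → Function.Bijective e

/-- The short exact sequence `ξ : 0 ⟶ K' ⟶ X ⟶ Y ⟶ 0` is a universal `L`-extension of `Y` by `K`,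
for a finitely generated `Γ(K)`-submodule `L` of `Ext¹(Y, K)`. -/
structure IsUniversalSubExtension {ξ : ShortComplex A} (hξ : ξ.ShortExact) (K : A)
    (L : Submodule (End K) (Abelian.Ext.{w} ξ.X₃ K 1)) : Prop where
  fg : L.FG
  mem_add : InAdd K ξ.X₁
  range_eq : LinearMap.range (connectingMap hξ K) = L
  right_minimal : IsRightMinimalLinear (connectingMap.{w} hξ K)

/-- The short exact sequence `ξ : 0 ⟶ K' ⟶ X ⟶ Y ⟶ 0` is a universal extension of `Y` by `K`:
`Ext¹(Y, K)` is a finitely generated `Γ(K)`-module and `ξ` is a universal `Ext¹(Y, K)`-extension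
of `Y` by `K`. -/
def IsUniversalExtension {ξ : ShortComplex A} (hξ : ξ.ShortExact) (K : A) : Prop :=
  IsUniversalSubExtension.{w} hξ K ⊤

end Extensions

/-! ### The two stable categories -/

section Stable

variable {A : Type u} [Category.{v} A] [Abelian A] [HasExt.{w} A]

/-- `f : X ⟶ Y` is projectively trivial: `Ext¹(f, -) = 0`. -/
def IsProjTrivial {X Y : A} (f : X ⟶ Y) : Prop :=
  ∀ (Z : A) (e : Abelian.Ext.{w} Y Z 1), (Abelian.Ext.mk₀ f).comp e (zero_add 1) = 0

/-- `f : X ⟶ Y` is injectively trivial: `Ext¹(-, f) = 0`. -/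
def IsInjTrivial {X Y : A} (f : X ⟶ Y) : Prop :=
  ∀ (Z : A) (e : Abelian.Ext.{w} Z X 1), e.comp (Abelian.Ext.mk₀ f) (add_zero 1) = 0

lemma isProjTrivial_sub_iff {X Y : A} (f g : X ⟶ Y) :
    IsProjTrivial.{w} (f - g) ↔ ∀ (Z : A) (e : Abelian.Ext.{w} Y Z 1),
      (Abelian.Ext.mk₀ f).comp e (zero_add 1) = (Abelian.Ext.mk₀ g).comp e (zero_add 1) := by
  refine forall₂_congr fun Z e => ?_
  rw [sub_eq_add_neg, Abelian.Ext.mk₀_add, Abelian.Ext.mk₀_neg, Abelian.Ext.add_comp,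
    Abelian.Ext.neg_comp, add_neg_eq_zero]

lemma isInjTrivial_sub_iff {X Y : A} (f g : X ⟶ Y) :
    IsInjTrivial.{w} (f - g) ↔ ∀ (Z : A) (e : Abelian.Ext.{w} Z X 1),
      e.comp (Abelian.Ext.mk₀ f) (add_zero 1) = e.comp (Abelian.Ext.mk₀ g) (add_zero 1) := by
  refine forall₂_congr fun Z e => ?_
  rw [sub_eq_add_neg, Abelian.Ext.mk₀_add, Abelian.Ext.mk₀_neg, Abelian.Ext.comp_add,
    Abelian.Ext.comp_neg, add_neg_eq_zero]

variable (A)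

/-- Two parallel morphisms are identified if their difference is projectively trivial. -/
def projRel : HomRel A := fun _ _ f g => IsProjTrivial.{w} (f - g)

/-- Two parallel morphisms are identified if their difference is injectively trivial. -/
def injRel : HomRel A := fun _ _ f g => IsInjTrivial.{w} (f - g)

instance projRel_congruence : Congruence (projRel.{w} A) where
  comp_left f g g' h := by
    rw [projRel, isProjTrivial_sub_iff] at h ⊢
    intro Z e
    rw [← Abelian.Ext.mk₀_comp_mk₀_assoc, ← Abelian.Ext.mk₀_comp_mk₀_assoc, h]
  comp_right g h := by
    rw [projRel, isProjTrivial_sub_iff] at h ⊢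
    intro Z e
    rw [← Abelian.Ext.mk₀_comp_mk₀_assoc, ← Abelian.Ext.mk₀_comp_mk₀_assoc, h]
  equivalence :=
    { refl := fun f => by rw [projRel, isProjTrivial_sub_iff]; exact fun _ _ => rfl
      symm := fun h => by
        rw [projRel, isProjTrivial_sub_iff] at h ⊢; exact fun Z e => (h Z e).symm
      trans := fun h h' => by
        rw [projRel, isProjTrivial_sub_iff] at h h' ⊢
        exact fun Z e => (h Z e).trans (h' Z e) }

lemma injRel_comp_aux {X Y Z T : A} (e : Abelian.Ext.{w} T X 1) (f : X ⟶ Y) (g : Y ⟶ Z) :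
    e.comp (Abelian.Ext.mk₀ (f ≫ g)) (add_zero 1) =
      (e.comp (Abelian.Ext.mk₀ f) (add_zero 1)).comp (Abelian.Ext.mk₀ g) (add_zero 1) := by
  rw [← Abelian.Ext.mk₀_comp_mk₀, Abelian.Ext.comp_assoc_of_third_deg_zero]

instance injRel_congruence : Congruence (injRel.{w} A) where
  comp_left f g g' h := by
    rw [injRel, isInjTrivial_sub_iff] at h ⊢
    intro Z e
    rw [injRel_comp_aux, injRel_comp_aux, h]
  comp_right g h := by
    rw [injRel, isInjTrivial_sub_iff] at h ⊢
    intro Z e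
    rw [injRel_comp_aux, injRel_comp_aux, h]
  equivalence :=
    { refl := fun f => by rw [injRel, isInjTrivial_sub_iff]; exact fun _ _ => rfl
      symm := fun h => by
        rw [injRel, isInjTrivial_sub_iff] at h ⊢; exact fun Z e => (h Z e).symm
      trans := fun h h' => by
        rw [injRel, isInjTrivial_sub_iff] at h h' ⊢
        exact fun Z e => (h Z e).trans (h' Z e) }

lemma projRel_add ⦃X Y : A⦄ (f₁ f₂ g₁ g₂ : X ⟶ Y) (h : projRel.{w} A f₁ f₂)
    (h' : projRel.{w} A g₁ g₂) : projRel.{w} A (f₁ + g₁) (f₂ + g₂) := by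
  rw [projRel, isProjTrivial_sub_iff] at h h' ⊢
  intro Z e
  rw [Abelian.Ext.mk₀_add, Abelian.Ext.mk₀_add, Abelian.Ext.add_comp, Abelian.Ext.add_comp,
    h, h']

lemma injRel_add ⦃X Y : A⦄ (f₁ f₂ g₁ g₂ : X ⟶ Y) (h : injRel.{w} A f₁ f₂)
    (h' : injRel.{w} A g₁ g₂) : injRel.{w} A (f₁ + g₁) (f₂ + g₂) := by
  rw [injRel, isInjTrivial_sub_iff] at h h' ⊢
  intro Z e
  rw [Abelian.Ext.mk₀_add, Abelian.Ext.mk₀_add, Abelian.Ext.comp_add, Abelian.Ext.comp_add,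
    h, h']

lemma projRel_smul {k : Type*} [CommRing k] [Linear k A] (a : k) ⦃X Y : A⦄ (f₁ f₂ : X ⟶ Y)
    (h : projRel.{w} A f₁ f₂) : projRel.{w} A (a • f₁) (a • f₂) := by
  rw [projRel, isProjTrivial_sub_iff] at h ⊢
  intro Z e
  rw [Abelian.Ext.mk₀_smul, Abelian.Ext.mk₀_smul, Abelian.Ext.smul_comp, Abelian.Ext.smul_comp, h]

lemma injRel_smul {k : Type*} [CommRing k] [Linear k A] (a : k) ⦃X Y : A⦄ (f₁ f₂ : X ⟶ Y)
    (h : injRel.{w} A f₁ f₂) : injRel.{w} A (a • f₁) (a • f₂) := by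
  rw [injRel, isInjTrivial_sub_iff] at h ⊢
  intro Z e
  rw [Abelian.Ext.mk₀_smul, Abelian.Ext.mk₀_smul, Abelian.Ext.comp_smul, Abelian.Ext.comp_smul, h]

/-- The factor category of `A` modulo projectively trivial morphisms. -/
abbrev ProjStable := Quotient (projRel.{w} A)

/-- The factor category of `A` modulo injectively trivial morphisms. -/
abbrev InjStable := Quotient (injRel.{w} A)

/-- The projection of `A` onto its factor category modulo projectively trivial morphisms. -/
abbrev toProj : A ⥤ ProjStable.{w} A := Quotient.functor (projRel.{w} A)

/-- The projection of `A` onto its factor category modulo injectively trivial morphisms. -/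
abbrev toInj : A ⥤ InjStable.{w} A := Quotient.functor (injRel.{w} A)

instance projStable_preadditive : Preadditive (ProjStable.{w} A) :=
  Quotient.preadditive _ (projRel_add.{w} A)

instance injStable_preadditive : Preadditive (InjStable.{w} A) :=
  Quotient.preadditive _ (injRel_add.{w} A)

instance toProj_additive : (toProj.{w} A).Additive :=
  Quotient.functor_additive _ (projRel_add.{w} A)

instance toInj_additive : (toInj.{w} A).Additive :=
  Quotient.functor_additive _ (injRel_add.{w} A)

instance projStable_linear (k : Type*) [CommRing k] [Linear k A] :
    Linear k (ProjStable.{w} A) :=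
  Quotient.linear k _ (projRel_smul.{w} A)

instance injStable_linear (k : Type*) [CommRing k] [Linear k A] :
    Linear k (InjStable.{w} A) :=
  Quotient.linear k _ (injRel_smul.{w} A)

end Stable

/-! ### Auslander-Reiten duality -/

/-- `E` is a minimal injective cogenerator of the commutative artinian ring `k`: an injective hull
of the direct sum of the simple `k`-modules `k ⧸ m`, one for each maximal ideal `m`. -/
def IsMinimalInjectiveCogenerator (k : Type t) [CommRing k] (E : Type t) [AddCommGroup E]
    [Module k E] : Prop :=
  Module.Injective k E ∧
    ∃ j : (DirectSum (MaximalSpectrum k) fun m => k ⧸ m.asIdeal) →ₗ[k] E,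
      Function.Injective j ∧ ∀ N : Submodule k E, N ⊓ LinearMap.range j = ⊥ → N = ⊥

/-- All Hom modules of the `k`-linear category `A` are finitely generated. -/
def IsHomFinite (k : Type*) [CommRing k] (A : Type u) [Category.{v} A] [Preadditive A]
    [Linear k A] : Prop :=
  ∀ X Y : A, Module.Finite k (X ⟶ Y)

/-- Auslander-Reiten duality for a `k`-linear abelian category `A`, with respect to the duality
`D = Hom_k(-, E)`: a `k`-linear equivalence `τ` from the category modulo projectively trivial
morphisms to the category modulo injectively trivial morphisms, together with `k`-linear
isomorphisms `Φ X Y : D Ext¹(X, Y) ≃ Hom(Y, τ X)` (Hom modulo injectively trivial morphisms),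
natural in both variables. -/
structure AuslanderReitenDuality (k : Type*) [CommRing k] (E : Type*) [AddCommGroup E]
    [Module k E] (A : Type u) [Category.{v} A] [Abelian A] [Linear k A] [HasExt.{w} A] where
  /-- The Auslander-Reiten translation. -/
  τ : ProjStable.{w} A ≌ InjStable.{w} A
  additive : τ.functor.Additive
  linear : τ.functor.Linear k
  /-- The duality isomorphism. -/
  Φ (X Y : A) : (Abelian.Ext.{w} X Y 1 →ₗ[k] E) ≃ₗ[k]
    ((toInj.{w} A).obj Y ⟶ τ.functor.obj ((toProj.{w} A).obj X))
  natural_left {X X' : A} (Y : A) (f : X ⟶ X') (θ : Abelian.Ext.{w} X Y 1 →ₗ[k] E) :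
    Φ X' Y (θ ∘ₗ (Abelian.Ext.mk₀ f).precompOfLinear k Y (zero_add 1)) =
      Φ X Y θ ≫ τ.functor.map ((toProj.{w} A).map f)
  natural_right (X : A) {Y Y' : A} (g : Y' ⟶ Y) (θ : Abelian.Ext.{w} X Y 1 →ₗ[k] E) :
    Φ X Y' (θ ∘ₗ (Abelian.Ext.mk₀ g).postcompOfLinear k X (add_zero 1)) =
      (toInj.{w} A).map g ≫ Φ X Y θ

end

end ARUniv

namespace ARUniv

noncomputable section

/-! ### Modules -/

/-! Let `S` be the extension 0 → L → X → Y → 0 given by a right minimal, right `C`-determined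
epimorphism. The core is that determination forces the class of `S` into the span of its pushouts
along maps L → K → L (`extClass_mem_of_isRightDetermined`). Otherwise a functional on Ext¹(Y, L)
would separate the class from that span, and Auslander–Reiten duality would turn it into a test map
τ⁻¹L → Y contradicting determination.

The image of Hom(L, K) in Ext¹(Y, K) has at most n generators over `k`, where n depends only on the
finite length module Ext¹(Y, K). So the class of `S` is fixed by some Σ φ_j ψ_j with n summands
(`exists_sum_pushClass_eq`). Right minimality makes this endomorphism of L invertible, so L is a
summand of K^n. By universality each pushout along φ_j is also a pushout of the universal extension,
along some ω_j. Hence Σ ω_j ψ_j pushes the universal extension to `S`, and the resulting square of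
extensions over Y gives the exact sequence with K' = L. -/

lemma IsMinimalInjectiveCogenerator.exists_separating {k : Type t} [CommRing k] {E : Type t}
    [AddCommGroup E] [Module k E] (hE : IsMinimalInjectiveCogenerator k E)
    {M : Type*} [AddCommGroup M] [Module k M] (W : Submodule k M) {x : M} (hx : x ∉ W) :
    ∃ θ : M →ₗ[k] E, (∀ y ∈ W, θ y = 0) ∧ θ x ≠ 0 := by
  classical
  obtain ⟨hinj, j, hj, -⟩ := hE
  have hB : Module.Baer k E := Module.Baer.of_injective hinj
  have hx' : W.mkQ x ≠ 0 := by simpa using hx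
  -- The annihilator of the nonzero coset lies in a maximal ideal `m`, so its span maps onto `k ⧸
  -- m`, which embeds in `E`; injectivity extends this map to `M ⧸ W`.
  have hne : Ideal.torsionOf k (M ⧸ W) (W.mkQ x) ≠ ⊤ := by
    rwa [Ne, Ideal.torsionOf_eq_top_iff]
  obtain ⟨m, hm, hle⟩ := Ideal.exists_le_maximal _ hne
  let f : Submodule.span k {W.mkQ x} →ₗ[k] E :=
    j ∘ₗ DirectSum.lof k (MaximalSpectrum k) (fun m => k ⧸ m.asIdeal) ⟨m, hm⟩ ∘ₗ
      Submodule.factor hle ∘ₗ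
        (Ideal.quotTorsionOfEquivSpanSingleton k (M ⧸ W) (W.mkQ x)).symm.toLinearMap
  obtain ⟨h, hh⟩ := hB.extension_property (Submodule.span k {W.mkQ x}).subtype
    (Submodule.injective_subtype _) f
  refine ⟨h ∘ₗ W.mkQ, fun y hy => ?_, fun h0 => ?_⟩
  · have : W.mkQ y = 0 := by simpa using hy
    rw [LinearMap.comp_apply, this, map_zero]
  · have key := LinearMap.congr_fun hh ⟨W.mkQ x, Submodule.mem_span_singleton_self _⟩
    rw [LinearMap.comp_apply, Submodule.subtype_apply] at key
    rw [LinearMap.comp_apply, key] at h0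
    have hone : (Ideal.quotTorsionOfEquivSpanSingleton k (M ⧸ W) (W.mkQ x)).symm
        ⟨W.mkQ x, Submodule.mem_span_singleton_self _⟩ = Submodule.Quotient.mk 1 := by
      rw [LinearEquiv.symm_apply_eq, Ideal.quotTorsionOfEquivSpanSingleton_apply_mk, one_smul]
    have h1 := (map_eq_zero_iff j hj).1 h0
    have h2 := (map_eq_zero_iff _ (DirectSum.of_injective (β := fun m : MaximalSpectrum k =>
      k ⧸ m.asIdeal) ⟨m, hm⟩)).1 h1
    simp only [LinearMap.comp_apply, LinearEquiv.coe_coe] at h2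
    rw [hone] at h2
    have h3 : (1 : k) ∈ m := (Submodule.Quotient.mk_eq_zero m).1 h2
    exact hm.ne_top ((Ideal.eq_top_iff_one m).2 h3)

/-- The number of generators of the submodules of a module of finite length is bounded. -/
lemma exists_bound_generators {k : Type*} [Ring k] {M : Type*} [AddCommGroup M] [Module k M]
    (h : IsFiniteLength k M) :
    ∃ n : ℕ, ∀ U : Submodule k M, ∃ f : Fin n → M, Submodule.span k (Set.range f) = U := by
  induction h with
  | of_subsingleton =>
    exact ⟨0, fun U => ⟨fun _ => 0, Subsingleton.elim _ _⟩⟩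
  | @of_simple_quotient M _ _ N hs _ ih =>
    obtain ⟨n, hn⟩ := ih
    refine ⟨n + 1, fun U => ?_⟩
    obtain ⟨f, hf⟩ := hn (U.comap N.subtype)
    have hfU : Submodule.span k (Set.range fun i => (f i : M)) = U ⊓ N := by
      have := congrArg (Submodule.map N.subtype) hf
      rw [Submodule.map_span, ← Set.range_comp, Submodule.map_comap_subtype, inf_comm] at this
      exact this
    -- Generators of `U ⊓ N` either suffice, padded by 0, or need one more element: since `M ⧸ N` is
    -- simple, any `x` in `U` outside `N` generates it.
    by_cases hU : U ≤ N
    · refine ⟨Fin.cons 0 fun i => (f i : M), ?_⟩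
      rw [Fin.range_cons, Submodule.span_insert, hfU, inf_eq_left.2 hU]
      simp
    · obtain ⟨x, hxU, hxN⟩ := SetLike.not_le_iff_exists.1 hU
      refine ⟨Fin.cons x fun i => (f i : M), ?_⟩
      rw [Fin.range_cons, Submodule.span_insert, hfU]
      refine le_antisymm (sup_le ((Submodule.span_singleton_le_iff_mem _ _).2 hxU) inf_le_left)
        fun y hy => ?_
      have hx0 : N.mkQ x ≠ 0 := by simpa using hxN
      obtain ⟨r, hr⟩ := Submodule.mem_span_singleton.1
        ((IsSimpleModule.span_singleton_eq_top k hx0).symm ▸ Submodule.mem_top :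
          N.mkQ y ∈ Submodule.span k {N.mkQ x})
      have hyN : y - r • x ∈ N := by
        rw [← Submodule.Quotient.mk_eq_zero, Submodule.Quotient.mk_sub, Submodule.Quotient.mk_smul]
        exact sub_eq_zero.2 hr.symm
      rw [← add_sub_cancel (r • x) y]
      exact Submodule.add_mem_sup (Submodule.smul_mem _ _ (Submodule.mem_span_singleton_self x))
        ⟨U.sub_mem hy (U.smul_mem r hxU), hyN⟩

/-! ### Pushouts of extensions -/

section Extensions

variable {A : Type u} [Category.{v} A] [Abelian A] [HasExt.{w} A]

/-- The `k`-linear map `Hom(S.X₁, Z) → Ext¹(S.X₃, Z)` sending `f` to the class of the pushout of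
the short exact sequence `S` along `f`. -/
def pushClass (k : Type*) [CommRing k] [Linear k A] {S : ShortComplex A} (hS : S.ShortExact)
    (Z : A) : (S.X₁ ⟶ Z) →ₗ[k] Abelian.Ext.{w} S.X₃ Z 1 where
  toFun f := hS.extClass.comp (Abelian.Ext.mk₀ f) (add_zero 1)
  map_add' f g := by rw [Abelian.Ext.mk₀_add, Abelian.Ext.comp_add]
  map_smul' r f := by rw [Abelian.Ext.mk₀_smul, Abelian.Ext.comp_smul, RingHom.id_apply]

section

variable (k : Type*) [CommRing k] [Linear k A] {S : ShortComplex A} (hS : S.ShortExact)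

lemma pushClass_apply {Z : A} (f : S.X₁ ⟶ Z) :
    pushClass.{w} k hS Z f = hS.extClass.comp (Abelian.Ext.mk₀ f) (add_zero 1) := rfl

lemma pushClass_comp {Z Z' : A} (f : S.X₁ ⟶ Z) (g : Z ⟶ Z') :
    pushClass.{w} k hS Z' (f ≫ g) =
      (pushClass.{w} k hS Z f).comp (Abelian.Ext.mk₀ g) (add_zero 1) :=
  injRel_comp_aux A _ f g

lemma pushClass_id : pushClass.{w} k hS S.X₁ (𝟙 S.X₁) = hS.extClass :=
  Abelian.Ext.comp_mk₀_id _

end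

/-- A morphism `t` factors through `S.g` if and only if the pullback of `S` along `t` splits. -/
lemma exists_lift_iff {S : ShortComplex A} (hS : S.ShortExact) {T : A} (t : T ⟶ S.X₃) :
    (∃ s : T ⟶ S.X₂, s ≫ S.g = t) ↔
      (Abelian.Ext.mk₀ t).comp hS.extClass (zero_add 1) = (0 : Abelian.Ext.{w} T S.X₁ 1) := by
  constructor
  · rintro ⟨s, rfl⟩
    rw [← Abelian.Ext.mk₀_comp_mk₀_assoc, hS.comp_extClass, Abelian.Ext.comp_zero]
  · intro h
    obtain ⟨x, hx⟩ := Abelian.Ext.covariant_sequence_exact₃ T hS _ (zero_add 1) h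
    obtain ⟨s, rfl⟩ := Abelian.Ext.addEquiv₀.symm.surjective x
    refine ⟨s, Abelian.Ext.addEquiv₀.symm.injective ?_⟩
    simpa using hx

/-- A morphism `f` factors through `S.f` if the pushout of `S` along `f` splits. -/
lemma exists_extension {S : ShortComplex A} (hS : S.ShortExact) {Z : A} (f : S.X₁ ⟶ Z)
    (h : hS.extClass.comp (Abelian.Ext.mk₀ f) (add_zero 1) = (0 : Abelian.Ext.{w} S.X₃ Z 1)) :
    ∃ s : S.X₂ ⟶ Z, S.f ≫ s = f := by
  obtain ⟨x, hx⟩ := Abelian.Ext.contravariant_sequence_exact₁ hS Z _ (add_zero 1) h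
  obtain ⟨s, rfl⟩ := Abelian.Ext.addEquiv₀.symm.surjective x
  refine ⟨s, Abelian.Ext.addEquiv₀.symm.injective ?_⟩
  simpa using hx

/-- If `S.g` is right minimal, an endomorphism of `S.X₁` fixing the class of `S` is invertible. -/
lemma isIso_of_pushClass_eq {S : ShortComplex A} (hS : S.ShortExact)
    (hmin : IsRightMinimal S.g) (e : S.X₁ ⟶ S.X₁)
    (he : hS.extClass.comp (Abelian.Ext.mk₀ e) (add_zero 1) =
      (hS.extClass : Abelian.Ext.{w} S.X₃ S.X₁ 1)) : IsIso e := by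
  have := hS.mono_f
  -- As `e - 𝟙` kills the class, it extends to `s` on the middle term. Then `𝟙 + s ≫ S.f` is an
  -- endomorphism over `S.X₃` restricting to `e`; minimality inverts it, and its inverse restricts
  -- to `e⁻¹`.
  obtain ⟨s, hs⟩ := exists_extension.{w} hS (e - 𝟙 _) (by
    rw [sub_eq_add_neg, Abelian.Ext.mk₀_add, Abelian.Ext.mk₀_neg, Abelian.Ext.comp_add,
      Abelian.Ext.comp_neg, he, Abelian.Ext.comp_mk₀_id, add_neg_cancel])
  have hx : (𝟙 S.X₂ + s ≫ S.f) ≫ S.g = S.g := by simp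
  have hfx : S.f ≫ (𝟙 S.X₂ + s ≫ S.f) = e ≫ S.f := by
    rw [Preadditive.comp_add, reassoc_of% hs, Preadditive.sub_comp]
    simp
  have := hmin _ hx
  have hinv : inv (𝟙 S.X₂ + s ≫ S.f) ≫ S.g = S.g := by
    rw [IsIso.inv_comp_eq, hx]
  let e' : S.X₁ ⟶ S.X₁ := hS.exact.lift (S.f ≫ inv (𝟙 S.X₂ + s ≫ S.f)) (by
    rw [Category.assoc, hinv, S.zero])
  have he' : e' ≫ S.f = S.f ≫ inv (𝟙 S.X₂ + s ≫ S.f) := hS.exact.lift_f _ _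
  refine ⟨e', ?_, ?_⟩
  · rw [← cancel_mono S.f, Category.assoc, he', ← Category.assoc, ← hfx, Category.assoc,
      IsIso.hom_inv_id, Category.comp_id, Category.id_comp]
  · rw [← cancel_mono S.f, Category.assoc, ← hfx, ← Category.assoc, he', Category.assoc,
      IsIso.inv_hom_id, Category.comp_id, Category.id_comp]

end Extensions

/-! ### Direct summands, and the exact sequence of a map of extensions -/

section Retract

variable {A : Type u} [Category.{v} A] [Abelian A]

lemma isDirectSummand_of_retract {X Z : A} (i : X ⟶ Z) (r : Z ⟶ X) (h : i ≫ r = 𝟙 X) :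
    IsDirectSummand X Z := by
  have : IsSplitMono i := ⟨⟨r, h⟩⟩
  exact ⟨cokernel i, ⟨biprod.uniqueUpToIso _ _
    (isBilimitBinaryBiconeOfIsSplitMonoOfCokernel (cokernelIsCokernel i)) |>.symm⟩⟩

lemma isDirectSummand_power {L K : A} {n : ℕ} (φ : Fin n → (L ⟶ K)) (ψ : Fin n → (K ⟶ L))
    (h : IsIso (∑ j, φ j ≫ ψ j)) : IsDirectSummand L (power K n) := by
  refine isDirectSummand_of_retract (biproduct.lift φ)
    (biproduct.desc ψ ≫ inv (∑ j, φ j ≫ ψ j)) ?_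
  rw [← Category.assoc, biproduct.lift_desc, IsIso.hom_inv_id]

lemma IsDirectSummand.exists_epi {X Z : A} (h : IsDirectSummand X Z) :
    ∃ q : Z ⟶ X, Epi q := by
  obtain ⟨X', ⟨e⟩⟩ := h
  exact ⟨e.inv ≫ biprod.fst, inferInstance⟩

/-- A morphism of short exact sequences which is the identity on the right-hand terms gives an
exact sequence `0 ⟶ S.X₁ ⟶ S.X₂ ⊞ S'.X₁ ⟶ S'.X₂ ⟶ 0`. -/
lemma exists_shortExact_biprod {S S' : ShortComplex A} (hS : S.ShortExact) (hS' : S'.ShortExact)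
    (a : S.X₂ ⟶ S'.X₂) (b : S.X₃ ≅ S'.X₃) (h : a ≫ S'.g = S.g ≫ b.hom) :
    ∃ (f : S.X₁ ⟶ S.X₂ ⊞ S'.X₁) (g : S.X₂ ⊞ S'.X₁ ⟶ S'.X₂) (hfg : f ≫ g = 0),
      (ShortComplex.mk f g hfg).ShortExact := by
  have := hS.mono_f
  have := hS'.mono_f
  have := hS.epi_g
  have := hS'.epi_g
  let u : S.X₁ ⟶ S'.X₁ := hS'.exact.lift (S.f ≫ a) (by
    rw [Category.assoc, h, S.zero_assoc, zero_comp])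
  have hu : u ≫ S'.f = S.f ≫ a := hS'.exact.lift_f _ _
  have hfg : biprod.lift S.f (-u) ≫ biprod.desc a S'.f = 0 := by
    rw [biprod.lift_desc, Preadditive.neg_comp, hu, add_neg_cancel]
  have hmono : Mono (biprod.lift S.f (-u)) :=
    mono_of_mono_fac (biprod.lift_fst S.f (-u))
  have hepi : Epi (biprod.desc a S'.f) := by
    refine Preadditive.epi_of_cancel_zero _ fun {Z} z hz => ?_
    have h1 : a ≫ z = 0 := by simpa using biprod.inl ≫= hz
    have h2 : S'.f ≫ z = 0 := by simpa using biprod.inr ≫= hz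
    have h3 : S'.g ≫ hS'.exact.desc z h2 = z := hS'.exact.g_desc _ _
    -- A map killing `S'.f` comes from `S'.X₃`; killing `a` as well, it vanishes there because `S.g`
    -- and `b` are epimorphisms.
    have h4 : S.g ≫ b.hom ≫ hS'.exact.desc z h2 = 0 := by
      rw [← Category.assoc, ← h, Category.assoc, h3, h1]
    have h5 : hS'.exact.desc z h2 = 0 := by
      rw [← cancel_epi b.hom, ← cancel_epi S.g, comp_zero, comp_zero, h4]
    rw [← h3, h5, comp_zero]
  refine ⟨biprod.lift S.f (-u), biprod.desc a S'.f, hfg, ⟨?_⟩⟩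
  refine ShortComplex.exact_of_f_is_kernel _
    (KernelFork.IsLimit.ofι' _ _ fun {T} x hx => ?_)
  have hx' : (x ≫ biprod.fst) ≫ a + (x ≫ biprod.snd) ≫ S'.f = 0 := by
    have : x ≫ biprod.desc a S'.f = 0 := hx
    simpa only [biprod.desc_eq, Preadditive.comp_add, Category.assoc] using this
  have h1 : (x ≫ biprod.fst) ≫ S.g = 0 := by
    have := hx' =≫ S'.g
    rw [Preadditive.add_comp, Category.assoc, Category.assoc _ S'.f, S'.zero, comp_zero, add_zero,
      h, zero_comp, ← Category.assoc] at this
    exact (cancel_mono b.hom).1 (this.trans zero_comp.symm)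
  have h2 : hS.exact.lift _ h1 ≫ S.f = x ≫ biprod.fst := hS.exact.lift_f _ _
  refine ⟨hS.exact.lift _ h1, ?_⟩
  change hS.exact.lift _ h1 ≫ biprod.lift S.f (-u) = x
  ext
  · rw [Category.assoc, biprod.lift_fst, h2]
  · rw [Category.assoc, biprod.lift_snd, ← cancel_mono S'.f, Preadditive.comp_neg,
      Preadditive.neg_comp, Category.assoc, hu, ← Category.assoc, h2]
    exact neg_eq_of_add_eq_zero_right hx'

end Retract

/-! ### Determined epimorphisms -/

section Determined

variable {k : Type t} [CommRing k] {E : Type t} [AddCommGroup E] [Module k E]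
  {A : Type u} [Category.{v} A] [Abelian A] [Linear k A] [HasExt.{w} A]

/-- If `S.g` is right `C`-determined and `τ C ≅ K`, then the class of `S` lies in each submodule
that contains the pushouts of `S` along all endomorphisms that factor through `K`. -/
lemma extClass_mem_of_isRightDetermined (hE : IsMinimalInjectiveCogenerator k E)
    (T : AuslanderReitenDuality.{w} k E A) {K C : A}
    (iso : T.τ.functor.obj ((toProj.{w} A).obj C) ≅ (toInj.{w} A).obj K)
    {S : ShortComplex A} (hS : S.ShortExact) (hdet : IsRightDetermined C S.g)
    (W : Submodule k (Abelian.Ext.{w} S.X₃ S.X₁ 1))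
    (hW : ∀ (g : S.X₁ ⟶ K) (v : K ⟶ S.X₁), pushClass.{w} k hS S.X₁ (g ≫ v) ∈ W) :
    hS.extClass ∈ W := by
  by_contra hmem
  obtain ⟨θ, hθW, hθ⟩ := hE.exists_separating W hmem
  -- With `T₀` = τ⁻¹L for L = `S.X₁`, the isomorphism L ≅ τ`T₀` corresponds to a functional `θ'`
  -- through which every functional on Ext¹(Y, L), Y = `S.X₃`, factors by pulling back along a map
  -- `T₀` → Y.
  let T₀ : A := (T.τ.inverse.obj ((toInj.{w} A).obj S.X₁)).as
  let j : (toInj.{w} A).obj S.X₁ ≅ T.τ.functor.obj ((toProj.{w} A).obj T₀) :=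
    (T.τ.counitIso.app ((toInj.{w} A).obj S.X₁)).symm
  obtain ⟨θ', hθ'⟩ := (T.Φ T₀ S.X₁).surjective j.hom
  obtain ⟨t', ht'⟩ := T.τ.functor.map_surjective (j.inv ≫ T.Φ S.X₃ S.X₁ θ)
  obtain ⟨t, rfl⟩ := (toProj.{w} A).map_surjective t'
  have hθt : θ' ∘ₗ (Abelian.Ext.mk₀ t).precompOfLinear k S.X₁ (zero_add 1) = θ := by
    apply (T.Φ S.X₃ S.X₁).injective
    rw [T.natural_left, hθ', ht', Iso.hom_inv_id_assoc]
  have hθt' (x : Abelian.Ext.{w} S.X₃ S.X₁ 1) :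
      θ' ((Abelian.Ext.mk₀ t).comp x (zero_add 1)) = θ x := LinearMap.congr_fun hθt x
  have hnot : ¬ ∃ s : T₀ ⟶ S.X₂, s ≫ S.g = t := by
    rw [exists_lift_iff.{w} hS]
    intro h0
    exact hθ (by rw [← hθt', h0, map_zero])
  obtain ⟨φ, hφ⟩ : ∃ φ : C ⟶ T₀, ¬ ∃ s : C ⟶ S.X₂, s ≫ S.g = φ ≫ t := by
    by_contra! hall
    exact hnot (hdet t hall)
  rw [exists_lift_iff.{w} hS] at hφ
  obtain ⟨η, -, hη⟩ := hE.exists_separating (⊥ : Submodule k (Abelian.Ext.{w} C S.X₁ 1))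
    (by simpa using hφ)
  -- `g` represents `η` as a map L → τC ≅ K, and `v` represents τφ as a map K → L. Naturality then
  -- trades pullback along `φ` for pushout along `g ≫ v`, where `θ` vanishes.
  obtain ⟨g, hg⟩ := (toInj.{w} A).map_surjective (T.Φ C S.X₁ η ≫ iso.hom)
  obtain ⟨v, hv⟩ := (toInj.{w} A).map_surjective
    (iso.inv ≫ T.τ.functor.map ((toProj.{w} A).map φ) ≫ j.inv)
  have hcomp : η ∘ₗ (Abelian.Ext.mk₀ φ).precompOfLinear k S.X₁ (zero_add 1) =
      θ' ∘ₗ (Abelian.Ext.mk₀ (g ≫ v)).postcompOfLinear k T₀ (add_zero 1) := by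
    apply (T.Φ T₀ S.X₁).injective
    rw [T.natural_left, T.natural_right, hθ', Functor.map_comp, hg, hv]
    simp
  apply hη
  have h1 : η ((Abelian.Ext.mk₀ φ).comp ((Abelian.Ext.mk₀ t).comp hS.extClass (zero_add 1))
      (zero_add 1)) = θ' (((Abelian.Ext.mk₀ t).comp hS.extClass (zero_add 1)).comp
        (Abelian.Ext.mk₀ (g ≫ v)) (add_zero 1)) := LinearMap.congr_fun hcomp _
  rw [← Abelian.Ext.mk₀_comp_mk₀_assoc, h1, Abelian.Ext.comp_assoc_of_third_deg_zero, hθt']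
  exact hθW _ (hW g v)

end Determined


/-! ### Bounding the number of factors through `K` -/

section Generators

variable {k : Type t} [CommRing k] {E : Type t} [AddCommGroup E] [Module k E]
  {A : Type u} [Category.{v} A] [Abelian A] [Linear k A] [HasExt.{w} A]

/-- If `S.g` is right `C`-determined, `τ C ≅ K`, and the pushouts of `S` along the morphisms `φ j`
generate those along all morphisms to `K`, then `S` is a pushout of itself along an endomorphism
that factors through `φ`. -/
lemma exists_sum_pushClass_eq (hE : IsMinimalInjectiveCogenerator k E)
    (T : AuslanderReitenDuality.{w} k E A) {K C : A}
    (iso : T.τ.functor.obj ((toProj.{w} A).obj C) ≅ (toInj.{w} A).obj K)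
    {S : ShortComplex A} (hS : S.ShortExact) (hdet : IsRightDetermined C S.g)
    {n : ℕ} (φ : Fin n → (S.X₁ ⟶ K))
    (hφ : ∀ g : S.X₁ ⟶ K,
      pushClass.{w} k hS K g ∈ Submodule.span k (Set.range fun j => pushClass.{w} k hS K (φ j))) :
    ∃ ψ : Fin n → (K ⟶ S.X₁), pushClass.{w} k hS S.X₁ (∑ j, φ j ≫ ψ j) = hS.extClass := by
  let F : (Fin n → (K ⟶ S.X₁)) →ₗ[k] Abelian.Ext.{w} S.X₃ S.X₁ 1 :=
    pushClass.{w} k hS S.X₁ ∘ₗ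
      { toFun := fun ψ => ∑ j, φ j ≫ ψ j
        map_add' := fun ψ ψ' => by simp [Finset.sum_add_distrib]
        map_smul' := fun r ψ => by simp [Finset.smul_sum] }
  refine extClass_mem_of_isRightDetermined hE T iso hS hdet (LinearMap.range F) fun g v => ?_
  obtain ⟨c, hc⟩ := (Submodule.mem_span_range_iff_exists_fun k).1 (hφ g)
  -- The coefficients expressing the pushout along `g` through those along `φ j` are absorbed into
  -- the second factor.
  refine ⟨fun j => c j • v, ?_⟩
  change pushClass.{w} k hS S.X₁ (∑ j, φ j ≫ (c j • v)) = _
  rw [pushClass_comp, ← hc, Abelian.Ext.sum_comp, map_sum]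
  refine Finset.sum_congr rfl fun j _ => ?_
  rw [Linear.comp_smul, map_smul, pushClass_comp, Abelian.Ext.smul_comp]

/-- If `Hom(S.X₁, K) → Ext¹(S.X₃, K)` is surjective, then `Ext¹(S.X₃, K)` is finitely generated. -/
lemma IsUniversalExtension.finite_ext (hfin : IsHomFinite k A) {K : A} {S : ShortComplex A}
    {hS : S.ShortExact} (h : IsUniversalExtension.{w} hS K) :
    Module.Finite k (Abelian.Ext.{w} S.X₃ K 1) := by
  have := hfin S.X₁ K
  have hsurj : Function.Surjective (connectingMap.{w} hS K) := LinearMap.range_eq_top.1 h.range_eq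
  exact Module.Finite.of_surjective (pushClass.{w} k hS K) hsurj

end Generators

end

end ARUniv

theorem proposition5p2 {k : Type t} [CommRing k] [IsArtinianRing k]
    {E : Type t} [AddCommGroup E] [Module k E] (hE : ARUniv.IsMinimalInjectiveCogenerator k E)
    {A : Type u} [Category.{v} A] [Abelian A] [Linear k A] [HasExt.{w} A]
    (hfin : ARUniv.IsHomFinite k A) (T : ARUniv.AuslanderReitenDuality.{w} k E A)
    (K Y : A) :
    ∃ n : ℕ,
      ∀ (C : A) (_ : Nonempty ((ARUniv.toProj.{w} A).obj C ≅
          T.τ.inverse.obj ((ARUniv.toInj.{w} A).obj K)))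
        (Kbar Xbar : A) (i : Kbar ⟶ Xbar) (p : Xbar ⟶ Y) (hip : i ≫ p = 0)
        (hξ : (ShortComplex.mk i p hip).ShortExact)
        (_ : ARUniv.IsUniversalExtension.{w} hξ K)
        (X : A) (_ : ARUniv.IsPresent C Y X),
        (∃ (K' : A) (_ : ARUniv.IsDirectSummand K' (ARUniv.power K n))
          (f : Kbar ⟶ Xbar ⊞ K') (g : Xbar ⊞ K' ⟶ X) (hfg : f ≫ g = 0),
          (ShortComplex.mk f g hfg).ShortExact) ∧
        ∃ q : Xbar ⊞ ARUniv.power K n ⟶ X, Epi q := by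
  open ARUniv in
  by_cases hExt : Module.Finite k (Abelian.Ext.{w} Y K 1)
  swap
  -- Here no universal extension exists, so the value 0 is arbitrary.
  · exact ⟨0, fun _ _ _ _ _ _ _ _ huniv => (hExt (huniv.finite_ext hfin)).elim⟩
  obtain ⟨n, hn⟩ := exists_bound_generators (k := k) (M := Abelian.Ext.{w} Y K 1)
    (isFiniteLength_iff_isNoetherian_isArtinian.2 ⟨inferInstance, inferInstance⟩)
  refine ⟨n, fun C ⟨hC⟩ Kbar Xbar i p hip hξ huniv X ⟨α, hα, hmin, hdet⟩ => ?_⟩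
  let S : ShortComplex A := ShortComplex.mk (kernel.ι α) α (kernel.condition α)
  have hS : S.ShortExact :=
    { exact := ShortComplex.exact_of_f_is_kernel S (kernelIsKernel α)
      mono_f := inferInstanceAs (Mono (kernel.ι α))
      epi_g := hα }
  let iso : T.τ.functor.obj ((toProj.{w} A).obj C) ≅ (toInj.{w} A).obj K :=
    T.τ.functor.mapIso hC ≪≫ T.τ.counitIso.app _
  obtain ⟨f, hf⟩ := hn (LinearMap.range (pushClass.{w} k hS K))
  have hmem (j : Fin n) : f j ∈ LinearMap.range (pushClass.{w} k hS K) :=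
    hf ▸ Submodule.subset_span ⟨j, rfl⟩
  choose φ hφ using hmem
  obtain ⟨ψ, hψ⟩ := exists_sum_pushClass_eq hE T iso hS hdet φ fun g => by
    simp only [hφ]
    exact hf.symm ▸ ⟨g, rfl⟩
  have hsummand : IsDirectSummand S.X₁ (power K n) :=
    isDirectSummand_power φ ψ (isIso_of_pushClass_eq.{w} hS hmin _ hψ)
  have hsurj := LinearMap.range_eq_top.1 huniv.range_eq
  choose ω hω using fun j => hsurj (pushClass.{w} k hS K (φ j))
  have hclass : hξ.extClass.comp (Abelian.Ext.mk₀ (∑ j, ω j ≫ ψ j)) (add_zero 1) =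
      hS.extClass := by
    change pushClass.{w} k hξ S.X₁ (∑ j, ω j ≫ ψ j) = _
    rw [← hψ, map_sum, map_sum]
    refine Finset.sum_congr rfl fun j _ => ?_
    rw [pushClass_comp, pushClass_comp, ← hω j]
    rfl
  -- The pullback of `S` along `p` splits, because `S` is a pushout of `hξ`'s sequence, which
  -- already splits when pulled back along `p`.
  obtain ⟨a, ha⟩ : ∃ a : Xbar ⟶ X, a ≫ α = p := by
    refine (exists_lift_iff.{w} hS p).2 ?_
    rw [← hclass]
    exact hξ.comp_extClass_assoc _ _
  obtain ⟨f', g', hfg, hex⟩ := exists_shortExact_biprod hξ hS a (Iso.refl Y)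
    (ha.trans (Category.comp_id p).symm)
  refine ⟨⟨S.X₁, hsummand, f', g', hfg, hex⟩, ?_⟩
  obtain ⟨q, hq⟩ := hsummand.exists_epi
  have : Epi g' := hex.epi_g
  exact ⟨biprod.map (𝟙 Xbar) q ≫ g', inferInstance⟩
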